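/- Let $d\ge 2$ and let $|\cdot|$ be the sup-norm on $\mathbb R^d$, $\mathcal B=\{x\in\mathbb R^d: |x|\le 1\}$. For $\tau=(\tau_1,\dots,\tau_d)\in\mathbb R^d$ with $\tau_1+\dots+\tau_d=0$ put $D_\tau=\mathrm{diag}(e^{\tau_1},\dots,e^{\tau_d})$ and $\mathcal B_\tau=D_\tau\mathcal B$. For a full-rank lattice $\Lambda\subset\mathbb R^d$ of covolume $1$ let $\Lambda^*=\{y\in\mathbb R^d:\langle y,x\rangle\in\mathbb Z\text{ for each }x\in\Lambda\}$ be the dual lattice, let $\lambda_k(\mathcal B_\tau,\Lambda)$, $1\le k\le d$, be the $k$-th successive minimum, i.e. the infimum of the positive $\lambda$ such that $\lambda\mathcal B_\tau$ contains at least $k$ linearly independent vectors of $\Lambda$, and put $$L_k(\tau,\Lambda)=\log\lambda_k(\mathcal B_\tau,\Lambda),\qquad S_k(\tau,\Lambda)=\sum_{1\le j\le k}L_j(\tau,\Lambda).$$ Then the following holds. (i) There is a constant $C$ depending only on $d$ such that for every full-rank lattice $\Lambda\subset\mathbb R^d$ of covolume $1$, every $\tau\in\mathbb R^d$ with $\tau_1+\dots+\tau_d=0$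 and every $k=1,\dots,d-1$, $$\bigl|S_k(\tau,\Lambda)-S_{d-k}(-\tau,\Lambda^*)\bigr|\le C,$$ that is, $S_k(\tau,\Lambda)=S_{d-k}(-\tau,\Lambda^*)+O(1)$. (ii) For every such $\Lambda$ and $\tau$, $$S_1(\tau,\Lambda)\le\dots\le\frac{S_k(\tau,\Lambda)}{k}\le\dots\le\frac{S_{d-1}(\tau,\Lambda)}{d-1},$$ that is, $\frac{S_k(\tau,\Lambda)}{k}\le\frac{S_{k+1}(\tau,\Lambda)}{k+1}$ for $k=1,\dots,d-2$. (iii) For every such $\Lambda$ and $\tau$, $$\frac{S_1(\tau,\Lambda)}{d-1}\ge\dots\ge\frac{S_k(\tau,\Lambda)}{d-k}\ge\dots\ge S_{d-1}(\tau,\Lambda),$$ that is, $\frac{S_k(\tau,\Lambda)}{d-k}\ge\frac{S_{k+1}(\tau,\Lambda)}{d-k-1}$ for $k=1,\dots,d-2$. -/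

import Mathlib

open scoped Pointwise

noncomputable section

namespace MultParamGeom

/-- The box `D_τ B`, where `D_τ = diag(e^{τ₁}, …, e^{τ_d})` and `B = {x : |x| ≤ 1}` is the unit
ball of the sup-norm (which is the norm of `Fin d → ℝ`). -/
def box {d : ℕ} (τ : Fin d → ℝ) : Set (Fin d → ℝ) :=
  (Matrix.diagonal fun i => Real.exp (τ i)).mulVec '' Metric.closedBall (0 : Fin d → ℝ) 1

/-- The `k`-th successive minimum of the set `K` with respect to `Λ`: the infimum of the positive
`r` such that `r K` contains at least `k` linearly independent vectors of `Λ`. -/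
def successiveMinimum {d : ℕ} (K : Set (Fin d → ℝ)) (Λ : Submodule ℤ (Fin d → ℝ)) (k : ℕ) : ℝ :=
  sInf {r : ℝ | 0 < r ∧ ∃ v : Fin k → (Fin d → ℝ),
    LinearIndependent ℝ v ∧ ∀ i, v i ∈ Λ ∧ v i ∈ r • K}

/-- `L_k(τ, Λ) = log λ_k(D_τ B, Λ)`. -/
def L {d : ℕ} (k : ℕ) (τ : Fin d → ℝ) (Λ : Submodule ℤ (Fin d → ℝ)) : ℝ :=
  Real.log (successiveMinimum (box τ) Λ k)

/-- `S_k(τ, Λ) = ∑_{1 ≤ j ≤ k} L_j(τ, Λ)`. -/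
def S {d : ℕ} (k : ℕ) (τ : Fin d → ℝ) (Λ : Submodule ℤ (Fin d → ℝ)) : ℝ :=
  ∑ j ∈ Finset.Icc 1 k, L j τ Λ

/-- The dual lattice `Λ* = {y : ⟨y, x⟩ ∈ ℤ for each x ∈ Λ}`. -/
def dualLattice {d : ℕ} (Λ : Submodule ℤ (Fin d → ℝ)) : Submodule ℤ (Fin d → ℝ) :=
  LinearMap.BilinForm.dualSubmodule (R := ℤ) (dotProductBilin ℝ ℝ) Λ

end MultParamGeom

end

/-!
Replacing `Λ` by `D_τ⁻¹ Λ` turns the box `D_τ B` into the unit ball of the sup-norm, and the dual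
lattice into `D_{-τ}⁻¹ Λ*`, so that only successive minima `λ_k` of the unit ball have to be
studied.

The upper bound is Minkowski's second theorem. The ball of radius `λ₁ / 2` injects into the quotient
by the lattice. For `k = 1, …, d - 1`, stretch the set obtained so far by the factor `λ_{k+1} / λ_k`
transversally to the span of the lattice vectors shorter than `λ_{k+1}`. Two points whose images are
congruent modulo the lattice differ, after the stretching, by a vector of this span, and such
differences are not changed by the stretching; hence the new set still injects into the quotient,
while the volume has been multiplied by at least `(λ_{k+1} / λ_k)^(d-k)`. The volume of the last set
is at most the covolume, which gives `S_d(τ, Λ) ≤ 0` and, for the dual lattice, `S_d(-τ, Λ*) ≤ 0`.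

Conversely, if `j + k > d`, then among `j` independent vectors of `Λ` and `k` of `Λ*` two have a
nonzero, hence integral, scalar product, so that `1 ≤ d λ_j λ*_k`. Summing this over the pairs with
`j + k = d + 1` and comparing with the upper bounds gives (i). The quotients in (ii) increase
because the `L_k` do, and (iii) uses in addition that `S_d ≤ 0`.
-/

namespace MultParamGeom

open Module MeasureTheory Metric

section Packing

lemma det_one_add_smul_of_isIdempotentElem {K V : Type*} [Field K] [AddCommGroup V] [Module K V]
    [FiniteDimensional K V] {P : V →ₗ[K] V} (hP : IsIdempotentElem P) (c : K) :
    LinearMap.det (1 + c • P) = (1 + c) ^ finrank K (LinearMap.range P) := by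
  have hcompl : IsCompl (LinearMap.range P) (LinearMap.ker P) :=
    LinearMap.IsIdempotentElem.isCompl hP
  set e := Submodule.prodEquivOfIsCompl _ _ hcompl with he
  have hconj : 1 + c • P = (e : (LinearMap.range P × LinearMap.ker P) →ₗ[K] V) ∘ₗ
      (LinearMap.prodMap ((1 + c) • 1) 1) ∘ₗ
        (e.symm : V →ₗ[K] LinearMap.range P × LinearMap.ker P) := by
    ext x
    obtain ⟨⟨⟨_, y, rfl⟩, u, hu⟩, rfl⟩ := e.surjective x
    have hPy : P (P y) = P y := LinearMap.congr_fun hP y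
    simp only [LinearMap.comp_apply, LinearEquiv.coe_coe, LinearEquiv.symm_apply_apply]
    simp only [he, Submodule.coe_prodEquivOfIsCompl', LinearMap.add_apply, End.one_apply,
      LinearMap.smul_apply, map_add, hPy, LinearMap.mem_ker.1 hu,
      LinearMap.prodMap_apply, SetLike.val_smul]
    module
  rw [hconj, LinearMap.det_conj, LinearMap.det_prodMap]
  simp

section TransversalStretch

variable {V : Type*} [AddCommGroup V] [Module ℝ V]

/-- The stretching by the factor `t` transversally to the kernel of the projection `P`: the coset
of `ker P` through `x` is translated by `t - 1` times its point `P x + σ (P x)`, which the selection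
`σ`, with values in `ker P`, picks out. -/
def transversalStretch (P : V →ₗ[ℝ] V) (σ : V → V) (t : ℝ) (x : V) : V :=
  x + (t - 1) • (P x + σ (P x))

variable {P : V →ₗ[ℝ] V} {σ : V → V} {t : ℝ}

lemma transversalStretch_eq_linearMap_add (x : V) :
    transversalStretch P σ t x = (1 + (t - 1) • P) x + (t - 1) • σ (P x) := by
  simp only [transversalStretch, LinearMap.add_apply, Module.End.one_apply, LinearMap.smul_apply]
  module

lemma apply_transversalStretch (hP : IsIdempotentElem P) (hPσ : ∀ y, P (σ y) = 0) (x : V) :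
    P (transversalStretch P σ t x) = t • P x := by
  have hPP : P (P x) = P x := LinearMap.congr_fun hP x
  rw [transversalStretch, map_add, map_smul, map_add, hPP, hPσ]
  module

lemma transversalStretch_sub_eq (hP : IsIdempotentElem P) (hPσ : ∀ y, P (σ y) = 0) (ht : t ≠ 0)
    {x y : V} (h : P (transversalStretch P σ t x - transversalStretch P σ t y) = 0) :
    transversalStretch P σ t x - transversalStretch P σ t y = x - y := by
  rw [map_sub, apply_transversalStretch hP hPσ, apply_transversalStretch hP hPσ, ← smul_sub,
    smul_eq_zero_iff_right ht, sub_eq_zero] at h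
  rw [transversalStretch, transversalStretch, h, add_sub_add_right_eq_sub]

lemma transversalStretch_injective (hP : IsIdempotentElem P) (hPσ : ∀ y, P (σ y) = 0)
    (ht : t ≠ 0) : Function.Injective (transversalStretch P σ t) := fun x y h => by
  rw [← sub_eq_zero, ← transversalStretch_sub_eq hP hPσ ht (by rw [h, sub_self, map_zero]), h,
    sub_self]

lemma norm_transversalStretch_lt {E : Type*} [NormedAddCommGroup E] [NormedSpace ℝ E]
    {P : E →ₗ[ℝ] E} {σ : E → E} {a : ℝ} (ht : 1 ≤ t) {x : E} (hx : ‖x‖ < a)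
    (hσx : ‖P x + σ (P x)‖ < a) : ‖transversalStretch P σ t x‖ < t * a :=
  calc ‖transversalStretch P σ t x‖ ≤ ‖x‖ + (t - 1) * ‖P x + σ (P x)‖ := by
        rw [← norm_smul_of_nonneg (sub_nonneg.2 ht)]
        exact norm_add_le _ _
    _ < a + (t - 1) * a := add_lt_add_of_lt_of_le hx
        (mul_le_mul_of_nonneg_left hσx.le (sub_nonneg.2 ht))
    _ = t * a := by ring

end TransversalStretch

lemma exists_measurable_nat_forall_mem {α : Type*} [MeasurableSpace α] {U : ℕ → Set α}
    (hU : ∀ n, MeasurableSet (U n)) :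
    ∃ N : α → ℕ, Measurable N ∧ ∀ x ∈ ⋃ n, U n, x ∈ U (N x) := by
  classical
  have hex (x : α) : ∃ n, x ∈ ⋃ m, U m → x ∈ U n := by
    by_cases hx : x ∈ ⋃ m, U m
    · exact (Set.mem_iUnion.1 hx).imp fun _ hn _ => hn
    · exact ⟨0, fun h => absurd h hx⟩
  exact ⟨fun x => Nat.find (hex x),
    measurable_find hex fun n => (MeasurableSet.iUnion hU).imp (hU n),
    fun x => Nat.find_spec (hex x)⟩

variable {E : Type*} [NormedAddCommGroup E] [NormedSpace ℝ E] [FiniteDimensional ℝ E]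
  [MeasurableSpace E] [BorelSpace E]

lemma exists_measurable_translation_norm_lt (V : Submodule ℝ E) (r : ℝ) :
    ∃ σ : E → E, Measurable σ ∧ (Set.range σ).Countable ∧ (∀ y, σ y ∈ V) ∧
      ∀ y, ∀ v ∈ V, ‖y + v‖ < r → ‖y + σ y‖ < r := by
  let u : ℕ → V := TopologicalSpace.denseSeq V
  obtain ⟨N, hN, hNu⟩ := exists_measurable_nat_forall_mem (U := fun n => {y : E | ‖y + u n‖ < r})
    fun n => measurableSet_lt (by fun_prop) (by fun_prop)
  refine ⟨fun y => u (N y), (measurable_from_nat (f := fun n => (u n : E))).comp hN,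
    (Set.countable_range fun n => (u n : E)).mono
      (Set.range_comp_subset_range N fun n => (u n : E)),
    fun y => (u (N y)).2, fun y v hv hyv => hNu y (Set.mem_iUnion.2 ?_)⟩
  have hopen : IsOpen {w : V | ‖y + w‖ < r} := isOpen_lt (by fun_prop) continuous_const
  exact (TopologicalSpace.denseRange_denseSeq V).exists_mem_open hopen ⟨⟨v, hv⟩, hyv⟩

variable (μ : Measure E) [μ.IsAddHaarMeasure]

lemma addHaar_image_linearMap_add_of_countable_range (T : E →ₗ[ℝ] E) {σ : E → E}
    (hσ : Measurable σ) (hσc : (Set.range σ).Countable)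
    (hinj : Function.Injective fun x => T x + σ x) {B : Set E} (hB : MeasurableSet B) :
    μ ((fun x => T x + σ x) '' B) = ENNReal.ofReal |LinearMap.det T| * μ B := by
  have := hσc.to_subtype
  let piece (c : Set.range σ) : Set E := B ∩ σ ⁻¹' {(c : E)}
  have hpiece (c : Set.range σ) : MeasurableSet (piece c) :=
    hB.inter (hσ (measurableSet_singleton _))
  have hdisj : Pairwise (Function.onFun Disjoint piece) := fun c c' hne =>
    ((Set.disjoint_singleton.2 (Subtype.coe_injective.ne hne)).preimage σ).mono
      Set.inter_subset_right Set.inter_subset_right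
  have hunion : B = ⋃ c, piece c := by
    ext x
    simp [piece]
  have himage (c : Set.range σ) :
      μ ((fun x => T x + σ x) '' piece c) = ENNReal.ofReal |LinearMap.det T| * μ (piece c) := by
    have : (fun x => T x + σ x) '' piece c = (· + (c : E)) '' (T '' piece c) := by
      rw [Set.image_image]
      exact Set.image_congr fun x hx => by rw [hx.2]
    rw [this, Set.image_add_right, measure_preimage_add_right, Measure.addHaar_image_linearMap]
  have hmeas : Measurable fun x => T x + σ x :=
    T.continuous_of_finiteDimensional.measurable.add hσ
  have hdisj_image : Pairwise (Function.onFun Disjoint fun c => (fun x => T x + σ x) '' piece c) :=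
    fun c c' hne => Set.disjoint_image_of_injective hinj (hdisj hne)
  rw [hunion, Set.image_iUnion, measure_iUnion hdisj_image fun c =>
    (hpiece c).image_of_measurable_injOn hmeas hinj.injOn, measure_iUnion hdisj hpiece,
    ← ENNReal.tsum_mul_left]
  exact tsum_congr himage

section

variable {P : E →ₗ[ℝ] E} {σ : E → E} {t : ℝ}

lemma measurable_transversalStretch (hσ : Measurable σ) (t : ℝ) :
    Measurable (transversalStretch P σ t) := by
  have hP : Measurable P := P.continuous_of_finiteDimensional.measurable
  exact measurable_id.add ((hP.add (hσ.comp hP)).const_smul (t - 1))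

lemma addHaar_image_transversalStretch (hP : IsIdempotentElem P) (hPσ : ∀ y, P (σ y) = 0)
    (ht : 0 < t) (hσ : Measurable σ) (hσc : (Set.range σ).Countable) {B : Set E}
    (hB : MeasurableSet B) :
    μ (transversalStretch P σ t '' B) =
      ENNReal.ofReal (t ^ finrank ℝ (LinearMap.range P)) * μ B := by
  have heq : transversalStretch P σ t = fun x => (1 + (t - 1) • P) x + (t - 1) • σ (P x) :=
    funext transversalStretch_eq_linearMap_add
  have hinj := transversalStretch_injective hP hPσ ht.ne'
  have hσP : Measurable fun x => (t - 1) • σ (P x) :=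
    (hσ.comp P.continuous_of_finiteDimensional.measurable).const_smul _
  have hσPc : (Set.range fun x => (t - 1) • σ (P x)).Countable := by
    refine (hσc.image ((t - 1) • ·)).mono ?_
    rintro _ ⟨x, rfl⟩
    exact ⟨σ (P x), ⟨P x, rfl⟩, rfl⟩
  rw [heq] at hinj ⊢
  rw [addHaar_image_linearMap_add_of_countable_range μ _ hσP hσPc hinj hB,
    det_one_add_smul_of_isIdempotentElem hP, add_sub_cancel, abs_of_nonneg (by positivity)]

end

lemma exists_transversal_stretch (V : Submodule ℝ E) {a b : ℝ} (ha : 0 < a) (hab : a ≤ b) :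
    ∃ f : E → E, Measurable f ∧ Function.Injective f ∧
      (∀ x y, f x - f y ∈ V → f x - f y = x - y) ∧ (∀ x, ‖x‖ < a → ‖f x‖ < b) ∧
      ∀ B, MeasurableSet B →
        μ (f '' B) = ENNReal.ofReal ((b / a) ^ (finrank ℝ E - finrank ℝ V)) * μ B := by
  obtain ⟨W, hVW⟩ := V.exists_isCompl
  have hP : IsIdempotentElem (W.projection V hVW.symm) :=
    Submodule.isIdempotentElem_projection hVW.symm
  set P := W.projection V hVW.symm with hPdef
  have hPV {x : E} : P x = 0 ↔ x ∈ V := Submodule.projection_apply_eq_zero_iff hVW.symm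
  obtain ⟨σ, hσ, hσc, hσV, hσa⟩ := exists_measurable_translation_norm_lt V a
  have hPσ (y : E) : P (σ y) = 0 := hPV.2 (hσV y)
  have hPP (x : E) : P (P x) = P x := LinearMap.congr_fun hP x
  have ht : 1 ≤ b / a := (one_le_div ha).2 hab
  have hcodim : finrank ℝ (LinearMap.range P) = finrank ℝ E - finrank ℝ V := by
    rw [hPdef, Submodule.range_projection, ← Submodule.finrank_add_eq_of_isCompl hVW,
      Nat.add_sub_cancel_left]
  refine ⟨transversalStretch P σ (b / a), measurable_transversalStretch hσ _,
    transversalStretch_injective hP hPσ (by positivity), fun x y h =>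
    transversalStretch_sub_eq hP hPσ (by positivity) (hPV.2 h), fun x hx => ?_, fun B hB => ?_⟩
  · have hsection : ‖P x + σ (P x)‖ < a :=
      hσa _ (x - P x) (hPV.1 (by rw [map_sub, hPP, sub_self]))
        (by rwa [add_sub_cancel])
    simpa only [div_mul_cancel₀ b ha.ne'] using norm_transversalStretch_lt ht hx hsection
  · rw [addHaar_image_transversalStretch μ hP hPσ (by positivity) hσ hσc hB, hcodim]

lemma exists_injOn_mkQ_stretch (Γ : Submodule ℤ E) (V : Submodule ℝ E) {a b : ℝ} (ha : 0 < a)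
    (hab : a ≤ b) (hV : ∀ x ∈ Γ, ‖x‖ < b → x ∈ V) {B : Set E} (hB : MeasurableSet B)
    (hBa : B ⊆ ball 0 (a / 2)) (hBΓ : Set.InjOn Γ.mkQ B) :
    ∃ B' : Set E, MeasurableSet B' ∧ B' ⊆ ball 0 (b / 2) ∧ Set.InjOn Γ.mkQ B' ∧
      μ B' = ENNReal.ofReal ((b / a) ^ (finrank ℝ E - finrank ℝ V)) * μ B := by
  obtain ⟨f, hf, hf_inj, hfV, hfab, hfμ⟩ :=
    exists_transversal_stretch μ V (half_pos ha) (div_le_div_of_nonneg_right hab zero_le_two)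
  have hfB {x : E} (hx : x ∈ B) : ‖f x‖ < b / 2 := hfab x (mem_ball_zero_iff.1 (hBa hx))
  refine ⟨f '' B, hB.image_of_measurable_injOn hf hf_inj.injOn, ?_, ?_, ?_⟩
  · rintro _ ⟨x, hx, rfl⟩
    exact mem_ball_zero_iff.2 (hfB hx)
  · rintro _ ⟨x, hx, rfl⟩ _ ⟨y, hy, rfl⟩ hxy
    have hΓ : f x - f y ∈ Γ := (Submodule.Quotient.eq Γ).1 hxy
    have hlt : ‖f x - f y‖ < b :=
      (norm_sub_le _ _).trans_lt (by linarith [hfB hx, hfB hy])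
    rw [hfV x y (hV _ hΓ hlt)] at hΓ
    rw [hBΓ hx hy ((Submodule.Quotient.eq Γ).2 hΓ)]
  · rw [hfμ B hB, div_div_div_cancel_right₀ two_ne_zero]

lemma measure_le_covolume_of_injOn_mkQ (Γ : Submodule ℤ E) [DiscreteTopology Γ] [IsZLattice ℝ Γ]
    {B : Set E} (hB : NullMeasurableSet B μ) (hBΓ : Set.InjOn Γ.mkQ B) :
    μ B ≤ ENNReal.ofReal (ZLattice.covolume Γ μ) := by
  have : MeasurableVAdd Γ E := (inferInstance : MeasurableVAdd Γ.toAddSubgroup E)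
  have : VAddInvariantMeasure Γ E μ := (inferInstance : VAddInvariantMeasure Γ.toAddSubgroup E μ)
  have fund := ZLattice.isAddFundamentalDomain (Free.chooseBasis ℤ Γ) μ
  rw [ZLattice.covolume_eq_measure_fundamentalDomain Γ μ fund, ofReal_measureReal
    (ZSpan.fundamentalDomain_isBounded _).measure_lt_top.ne]
  by_contra! hlt
  obtain ⟨x, hx, _, hy, g, hg, rfl⟩ := fund.exists_ne_zero_vadd_eq hB hlt
  have hgx : g +ᵥ x = x := hBΓ hy hx ((Submodule.Quotient.eq Γ).2 (by simp [Submodule.vadd_def]))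
  exact hg (Subtype.ext (by simpa [Submodule.vadd_def] using hgx))

end Packing

section Minima

variable {E : Type*} [NormedAddCommGroup E] [NormedSpace ℝ E] (Γ : Submodule ℤ E)

/-- The positive radii `r` such that the closed ball of radius `r` contains `k` linearly independent
vectors of `Γ`; their infimum is the `k`-th successive minimum. -/
def admissibleRadii (k : ℕ) : Set ℝ :=
  {r | 0 < r ∧ ∃ v : Fin k → E, LinearIndependent ℝ v ∧ ∀ i, v i ∈ Γ ∧ ‖v i‖ ≤ r}

/-- The `k`-th successive minimum of the unit ball with respect to `Γ`; it is `0` if `k = 0` or if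
`Γ` does not contain `k` linearly independent vectors. -/
noncomputable def latticeMinimum (k : ℕ) : ℝ :=
  sInf (admissibleRadii Γ k)

lemma bddBelow_admissibleRadii (k : ℕ) : BddBelow (admissibleRadii Γ k) :=
  ⟨0, fun _ hr => hr.1.le⟩

lemma exists_latticeMinimum_le_norm {k : ℕ} {v : Fin (k + 1) → E} (hv : LinearIndependent ℝ v)
    (hvΓ : ∀ i, v i ∈ Γ) : ∃ i, latticeMinimum Γ (k + 1) ≤ ‖v i‖ := by
  obtain ⟨i, hi⟩ := Finite.exists_max fun i => ‖v i‖
  exact ⟨i, csInf_le (bddBelow_admissibleRadii Γ _)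
    ⟨norm_pos_iff.2 (hv.ne_zero i), v, hv, fun j => ⟨hvΓ j, hi j⟩⟩⟩

lemma exists_linearIndependent_fin_of_le_finrank_span {K V : Type*} [DivisionRing K]
    [AddCommGroup V] [Module K V] {s : Set V} [Module.Finite K (Submodule.span K s)] {k : ℕ}
    (hk : k ≤ finrank K (Submodule.span K s)) :
    ∃ v : Fin k → V, LinearIndependent K v ∧ ∀ i, v i ∈ s := by
  obtain ⟨v, hvs, -, hv⟩ := Submodule.exists_fun_fin_finrank_span_eq K s
  exact ⟨v ∘ Fin.castLE hk, hv.comp _ (Fin.castLE_injective hk), fun i => hvs _⟩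

lemma finrank_span_norm_lt_latticeMinimum_le [FiniteDimensional ℝ E] (k : ℕ) :
    finrank ℝ (Submodule.span ℝ {x | x ∈ Γ ∧ ‖x‖ < latticeMinimum Γ (k + 1)}) ≤ k := by
  by_contra! hk
  obtain ⟨v, hv, hvΓ⟩ := exists_linearIndependent_fin_of_le_finrank_span (Nat.succ_le_of_lt hk)
  obtain ⟨i, hi⟩ := exists_latticeMinimum_le_norm Γ hv fun i => (hvΓ i).1
  exact (hvΓ i).2.not_ge hi

lemma injOn_mkQ_ball_latticeMinimum_one [FiniteDimensional ℝ E] :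
    Set.InjOn Γ.mkQ (ball 0 (latticeMinimum Γ 1 / 2)) := fun x hx y hy hxy => by
  have hspan := Submodule.finrank_eq_zero.1
    (Nat.le_zero.1 (finrank_span_norm_lt_latticeMinimum_le Γ 0))
  rw [mem_ball_zero_iff] at hx hy
  have hlt : ‖x - y‖ < latticeMinimum Γ 1 := (norm_sub_le _ _).trans_lt (by linarith)
  exact sub_eq_zero.1 ((Submodule.mem_bot ℝ).1 (hspan ▸ Submodule.subset_span
    ⟨(Submodule.Quotient.eq Γ).1 hxy, hlt⟩))

section ZLattice

variable [FiniteDimensional ℝ E] [DiscreteTopology Γ] [IsZLattice ℝ Γ]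

lemma admissibleRadii_nonempty {k : ℕ} (hk : k ≤ finrank ℝ E) : (admissibleRadii Γ k).Nonempty := by
  have hspan : k ≤ finrank ℝ (Submodule.span ℝ (Γ : Set E)) := by
    rwa [IsZLattice.span_top, finrank_top]
  obtain ⟨v, hv, hvΓ⟩ := exists_linearIndependent_fin_of_le_finrank_span hspan
  obtain ⟨r, hr⟩ := (Set.finite_range fun i => ‖v i‖).bddAbove
  exact ⟨max r 1, by positivity, v, hv, fun i =>
    ⟨hvΓ i, (hr (Set.mem_range_self i)).trans (le_max_left _ _)⟩⟩

lemma latticeMinimum_le_latticeMinimum {j k : ℕ} (hjk : j ≤ k) (hk : k ≤ finrank ℝ E) :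
    latticeMinimum Γ j ≤ latticeMinimum Γ k := by
  refine csInf_le_csInf (bddBelow_admissibleRadii Γ j) (admissibleRadii_nonempty Γ hk) ?_
  rintro r ⟨hr, v, hv, hvr⟩
  exact ⟨hr, v ∘ Fin.castLE hjk, hv.comp _ (Fin.castLE_injective hjk), fun i => hvr _⟩

lemma latticeMinimum_pos {k : ℕ} (hk0 : k ≠ 0) (hk : k ≤ finrank ℝ E) : 0 < latticeMinimum Γ k := by
  obtain ⟨ε, hε, hεΓ⟩ := exists_ball_inter_eq_singleton_of_mem_discrete
    (isDiscrete_iff_discreteTopology.2 ‹DiscreteTopology Γ›) Γ.zero_mem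
  refine hε.trans_le (le_csInf (admissibleRadii_nonempty Γ hk) ?_)
  rintro r ⟨-, v, hv, hvr⟩
  let i : Fin k := ⟨0, Nat.pos_of_ne_zero hk0⟩
  by_contra! hlt
  have hmem : v i ∈ ball 0 ε ∩ (Γ : Set E) :=
    ⟨mem_ball_zero_iff.2 ((hvr i).2.trans_lt hlt), (hvr i).1⟩
  exact hv.ne_zero i (by rwa [hεΓ] at hmem)

end ZLattice

section Minkowski

variable [FiniteDimensional ℝ E] [MeasurableSpace E] [BorelSpace E] (μ : Measure E)
  [μ.IsAddHaarMeasure] [DiscreteTopology Γ] [IsZLattice ℝ Γ]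

lemma exists_injOn_mkQ_latticeMinimum {k : ℕ} (hk : k < finrank ℝ E) :
    ∃ B : Set E, MeasurableSet B ∧ B ⊆ ball 0 (latticeMinimum Γ (k + 1) / 2) ∧
      Set.InjOn Γ.mkQ B ∧
      ENNReal.ofReal ((∏ i ∈ Finset.range k, latticeMinimum Γ (i + 1)) *
        latticeMinimum Γ (k + 1) ^ (finrank ℝ E - k)) * μ (ball 0 (1 / 2)) ≤ μ B := by
  induction k with
  | zero =>
    refine ⟨_, measurableSet_ball, subset_rfl, injOn_mkQ_ball_latticeMinimum_one Γ, le_of_eq ?_⟩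
    rw [Finset.prod_range_zero, one_mul, Nat.sub_zero, zero_add,
      div_eq_mul_one_div (latticeMinimum Γ 1),
      Measure.addHaar_ball_mul_of_pos μ _ (latticeMinimum_pos Γ one_ne_zero hk)]
  | succ k ih =>
    obtain ⟨B, hB, hBball, hBΓ, hBμ⟩ := ih (Nat.lt_of_succ_lt hk)
    have hpos : 0 < latticeMinimum Γ (k + 1) := latticeMinimum_pos Γ k.succ_ne_zero hk.le
    have hle : latticeMinimum Γ (k + 1) ≤ latticeMinimum Γ (k + 2) :=
      latticeMinimum_le_latticeMinimum Γ (Nat.le_succ _) hk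
    obtain ⟨B', hB', hB'ball, hB'Γ, hB'μ⟩ := exists_injOn_mkQ_stretch μ Γ
      (Submodule.span ℝ {x | x ∈ Γ ∧ ‖x‖ < latticeMinimum Γ (k + 2)}) hpos hle
      (fun x hx hxlt => Submodule.subset_span ⟨hx, hxlt⟩) hB hBball hBΓ
    refine ⟨B', hB', hB'ball, hB'Γ, ?_⟩
    have hprod : (∏ i ∈ Finset.range (k + 1), latticeMinimum Γ (i + 1)) *
          latticeMinimum Γ (k + 2) ^ (finrank ℝ E - (k + 1)) =
        (latticeMinimum Γ (k + 2) / latticeMinimum Γ (k + 1)) ^ (finrank ℝ E - (k + 1)) *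
          ((∏ i ∈ Finset.range k, latticeMinimum Γ (i + 1)) *
            latticeMinimum Γ (k + 1) ^ (finrank ℝ E - k)) := by
      rw [Finset.prod_range_succ, div_pow,
        show finrank ℝ E - k = finrank ℝ E - (k + 1) + 1 by omega, pow_succ]
      field_simp
    have hratio : 1 ≤ latticeMinimum Γ (k + 2) / latticeMinimum Γ (k + 1) := (one_le_div hpos).2 hle
    rw [hprod, hB'μ, ENNReal.ofReal_mul (by positivity), mul_assoc]
    gcongr
    exact finrank_span_norm_lt_latticeMinimum_le Γ (k + 1)

theorem prod_latticeMinimum_mul_measure_ball_le_covolume :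
    ENNReal.ofReal (∏ i ∈ Finset.range (finrank ℝ E), latticeMinimum Γ (i + 1)) *
      μ (ball 0 (1 / 2)) ≤ ENNReal.ofReal (ZLattice.covolume Γ μ) := by
  rcases Nat.eq_zero_or_eq_succ_pred (finrank ℝ E) with hn | hn
  · have : Subsingleton E := finrank_zero_iff.1 hn
    rw [hn, Finset.prod_range_zero, ENNReal.ofReal_one, one_mul]
    exact measure_le_covolume_of_injOn_mkQ μ Γ measurableSet_ball.nullMeasurableSet
      (Set.injOn_of_subsingleton _ _)
  · obtain ⟨B, hB, -, hBΓ, hBμ⟩ := exists_injOn_mkQ_latticeMinimum Γ μ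
      (k := (finrank ℝ E).pred) (by omega)
    have hle := hBμ.trans (measure_le_covolume_of_injOn_mkQ μ Γ hB.nullMeasurableSet hBΓ)
    rwa [show finrank ℝ E - (finrank ℝ E).pred = 1 by omega, pow_one, ← Finset.prod_range_succ,
      ← Nat.succ_eq_add_one, ← hn] at hle

end Minkowski

theorem sum_log_latticeMinimum_le_log_covolume {ι : Type*} [Fintype ι]
    (Γ : Submodule ℤ (ι → ℝ)) [DiscreteTopology Γ] [IsZLattice ℝ Γ] :
    ∑ i ∈ Finset.range (Fintype.card ι), Real.log (latticeMinimum Γ (i + 1)) ≤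
      Real.log (ZLattice.covolume Γ) := by
  have hpos : ∀ i ∈ Finset.range (Fintype.card ι), 0 < latticeMinimum Γ (i + 1) := fun i hi =>
    latticeMinimum_pos Γ i.succ_ne_zero (by simpa using hi)
  have hball : volume (ball (0 : ι → ℝ) (1 / 2)) = 1 := by
    simp [Real.volume_pi_ball]
  have hle := prod_latticeMinimum_mul_measure_ball_le_covolume Γ volume
  rw [hball, mul_one, ENNReal.ofReal_le_ofReal_iff (ZLattice.covolume_pos Γ _).le,
    finrank_fintype_fun_eq_card] at hle
  rw [← Real.log_prod fun i hi => (hpos i hi).ne']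
  exact Real.log_le_log (Finset.prod_pos hpos) hle

end Minima

section Duality

lemma exists_bilin_apply_ne_zero {K V : Type*} [Field K] [AddCommGroup V] [Module K V]
    [FiniteDimensional K V] {B : LinearMap.BilinForm K V} (hB : B.Nondegenerate) {j k : ℕ}
    (hjk : finrank K V < j + k) {u : Fin j → V} {w : Fin k → V} (hu : LinearIndependent K u)
    (hw : LinearIndependent K w) : ∃ a b, B (u a) (w b) ≠ 0 := by
  by_contra! h
  have hle : Submodule.span K (Set.range w) ≤ B.orthogonal (Submodule.span K (Set.range u)) := by
    rw [Submodule.span_le]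
    rintro _ ⟨b, rfl⟩ n hn
    induction hn using Submodule.span_induction with
    | mem _ hx => obtain ⟨a, rfl⟩ := hx; exact h a b
    | zero => simp
    | add _ _ _ _ hx hy => simp_all
    | smul _ _ _ hx => simp_all
  have hfinrank := Submodule.finrank_mono hle
  rw [LinearMap.BilinForm.finrank_orthogonal hB, finrank_span_eq_card hu, finrank_span_eq_card hw,
    Fintype.card_fin, Fintype.card_fin] at hfinrank
  have hj := hu.fintype_card_le_finrank
  rw [Fintype.card_fin] at hj
  omega

section

variable {E : Type*} [NormedAddCommGroup E] [NormedSpace ℝ E] [FiniteDimensional ℝ E]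
  {B : LinearMap.BilinForm ℝ E} {C : ℝ} {Γ Γ' : Submodule ℤ E} {j k : ℕ}

lemma one_le_mul_of_mem_admissibleRadii (hB : B.Nondegenerate)
    (hC : ∀ x y, |B x y| ≤ C * (‖x‖ * ‖y‖)) (hΓ : Γ' ≤ B.dualSubmodule Γ)
    (hjk : finrank ℝ E < j + k) {r s : ℝ} (hr : r ∈ admissibleRadii Γ j)
    (hs : s ∈ admissibleRadii Γ' k) : 1 ≤ C * (r * s) := by
  obtain ⟨hr0, u, hu, hur⟩ := hr
  obtain ⟨hs0, w, hw, hws⟩ := hs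
  obtain ⟨b, a, hne⟩ := exists_bilin_apply_ne_zero hB (by rwa [add_comm] at hjk) hw hu
  obtain ⟨n, hn⟩ := Submodule.mem_one.1 (hΓ (hws b).1 _ (hur a).1)
  have hn' : (n : ℝ) = B (w b) (u a) := hn
  rw [← hn', Int.cast_ne_zero] at hne
  calc (1 : ℝ) ≤ |B (w b) (u a)| := by
        rw [← hn', ← Int.cast_abs]
        exact_mod_cast Int.one_le_abs hne
    _ ≤ C * (‖u a‖ * ‖w b‖) := (hC _ _).trans_eq (by rw [mul_comm ‖w b‖])
    _ ≤ C * (r * s) := by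
        have hpos : 0 < ‖u a‖ * ‖w b‖ :=
          mul_pos (norm_pos_iff.2 (hu.ne_zero a)) (norm_pos_iff.2 (hw.ne_zero b))
        have hC0 : 0 ≤ C :=
          nonneg_of_mul_nonneg_left ((abs_nonneg _).trans (hC (u a) (w b))) hpos
        gcongr
        · exact (hur a).2
        · exact (hws b).2

lemma one_le_mul_latticeMinimum [DiscreteTopology Γ] [IsZLattice ℝ Γ]
    [DiscreteTopology Γ'] [IsZLattice ℝ Γ'] (hB : B.Nondegenerate)
    (hC : ∀ x y, |B x y| ≤ C * (‖x‖ * ‖y‖)) (hΓ : Γ' ≤ B.dualSubmodule Γ)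
    (hj : j ≤ finrank ℝ E) (hk : k ≤ finrank ℝ E) (hjk : finrank ℝ E < j + k) :
    1 ≤ C * (latticeMinimum Γ j * latticeMinimum Γ' k) := by
  have hrs {r s : ℝ} (hr : r ∈ admissibleRadii Γ j) (hs : s ∈ admissibleRadii Γ' k) :
      1 ≤ C * (r * s) :=
    one_le_mul_of_mem_admissibleRadii hB hC hΓ hjk hr hs
  obtain ⟨r₀, hr₀⟩ := admissibleRadii_nonempty Γ hj
  obtain ⟨s₀, hs₀⟩ := admissibleRadii_nonempty Γ' hk
  have hC0 : 0 < C :=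
    pos_of_mul_pos_left (one_pos.trans_le (hrs hr₀ hs₀)) (mul_pos hr₀.1 hs₀.1).le
  have hmin_mul {s : ℝ} (hs : s ∈ admissibleRadii Γ' k) :
      1 / (C * s) ≤ latticeMinimum Γ j :=
    le_csInf ⟨r₀, hr₀⟩ fun r hr => by
      rw [div_le_iff₀ (mul_pos hC0 hs.1), mul_left_comm]
      exact hrs hr hs
  have hpos : 0 < latticeMinimum Γ j := latticeMinimum_pos Γ (by omega) hj
  have hle : 1 / (C * latticeMinimum Γ j) ≤ latticeMinimum Γ' k :=
    le_csInf ⟨s₀, hs₀⟩ fun s hs => by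
      have := hmin_mul hs
      rw [div_le_iff₀ (mul_pos hC0 hs.1)] at this
      rw [div_le_iff₀ (mul_pos hC0 hpos)]
      linarith
  rwa [div_le_iff₀ (mul_pos hC0 hpos), mul_comm, mul_assoc] at hle

end

end Duality

section DualLattice

variable {d : ℕ}

lemma dotProductBilin_nondegenerate {K ι : Type*} [Field K] [Fintype ι] :
    LinearMap.BilinForm.Nondegenerate (dotProductBilin K K : LinearMap.BilinForm K (ι → K)) :=
  ⟨fun x hx => dotProduct_eq_zero x hx,
    fun x hx => dotProduct_eq_zero x fun y => (dotProduct_comm x y).trans (hx y)⟩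

lemma abs_dotProduct_le {ι : Type*} [Fintype ι] (x y : ι → ℝ) :
    |x ⬝ᵥ y| ≤ Fintype.card ι * (‖x‖ * ‖y‖) :=
  calc |x ⬝ᵥ y| ≤ ∑ i, |x i * y i| := Finset.abs_sum_le_sum_abs _ _
    _ ≤ ∑ _i : ι, ‖x‖ * ‖y‖ := Finset.sum_le_sum fun i _ => by
        rw [abs_mul]
        exact mul_le_mul (norm_le_pi_norm x i) (norm_le_pi_norm y i) (abs_nonneg _) (norm_nonneg _)
    _ = Fintype.card ι * (‖x‖ * ‖y‖) := by simp

lemma mem_dualLattice {Λ : Submodule ℤ (Fin d → ℝ)} {y : Fin d → ℝ} :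
    y ∈ dualLattice Λ ↔ ∀ x ∈ Λ, y ⬝ᵥ x ∈ (1 : Submodule ℤ ℝ) :=
  LinearMap.BilinForm.mem_dualSubmodule _

variable (Λ : Submodule ℤ (Fin d → ℝ)) [DiscreteTopology Λ] [IsZLattice ℝ Λ]

lemma dualLattice_eq_span_dualBasis :
    dualLattice Λ = Submodule.span ℤ (Set.range (LinearMap.BilinForm.dualBasis _
      dotProductBilin_nondegenerate ((IsZLattice.basis Λ).ofZLatticeBasis ℝ Λ))) := by
  rw [dualLattice, ← LinearMap.BilinForm.dualSubmodule_span_of_basis,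
    Basis.ofZLatticeBasis_span]

instance : DiscreteTopology (dualLattice Λ) := by
  rw [dualLattice_eq_span_dualBasis]
  infer_instance

instance : IsZLattice ℝ (dualLattice Λ) := by
  simp_rw [dualLattice_eq_span_dualBasis]
  infer_instance

lemma covolume_span_range_basis {ι : Type*} [Fintype ι] [DecidableEq ι]
    (b : Basis ι ℝ (ι → ℝ)) :
    ZLattice.covolume (Submodule.span ℤ (Set.range b)) = |(Matrix.of b).det| := by
  rw [ZLattice.covolume_eq_measure_fundamentalDomain _ volume
    (ZSpan.isAddFundamentalDomain b volume), ZSpan.volume_real_fundamentalDomain]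

lemma covolume_mul_covolume_dualLattice :
    ZLattice.covolume Λ * ZLattice.covolume (dualLattice Λ) = 1 := by
  let b := (IsZLattice.basis Λ).ofZLatticeBasis ℝ Λ
  let b' := LinearMap.BilinForm.dualBasis _ dotProductBilin_nondegenerate b
  have hbb' : Matrix.of b' * (Matrix.of b).transpose = 1 := by
    ext i j
    rw [Matrix.one_apply]
    simp only [eq_comm (a := i)]
    exact LinearMap.BilinForm.apply_dualBasis_left dotProductBilin_nondegenerate b i j
  have hb : ZLattice.covolume Λ = |(Matrix.of b).det| := by
    rw [← covolume_span_range_basis, Basis.ofZLatticeBasis_span]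
  have hb' : ZLattice.covolume (dualLattice Λ) = |(Matrix.of b').det| := by
    simp_rw [dualLattice_eq_span_dualBasis, covolume_span_range_basis]
    rfl
  rw [hb, hb', mul_comm, ← Matrix.det_transpose (Matrix.of b), ← abs_mul, ← Matrix.det_mul, hbb',
    Matrix.det_one, abs_one]

end DualLattice

section Rescaling

lemma covolume_comap_continuousLinearEquiv {E : Type*} [NormedAddCommGroup E] [NormedSpace ℝ E]
    [FiniteDimensional ℝ E] [MeasurableSpace E] [BorelSpace E] (μ : Measure E) [μ.IsAddHaarMeasure]
    (Λ : Submodule ℤ E) [DiscreteTopology Λ] [IsZLattice ℝ Λ] (e : E ≃L[ℝ] E) :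
    ZLattice.covolume (ZLattice.comap ℝ Λ e.toLinearMap) μ =
      |(LinearMap.det (e : E →ₗ[ℝ] E))⁻¹| * ZLattice.covolume Λ μ := by
  have hmap : Measure.map e μ = ENNReal.ofReal |(LinearMap.det (e : E →ₗ[ℝ] E))⁻¹| • μ :=
    Measure.map_linearMap_addHaar_eq_smul_addHaar μ e.toLinearEquiv.isUnit_det'.ne_zero
  have : (Measure.map e μ).IsAddHaarMeasure := e.isAddHaarMeasure_map μ
  let b := Free.chooseBasis ℤ Λ
  rw [ZLattice.covolume_comap Λ (Measure.map e μ) μ ⟨e.continuous.measurable, rfl⟩,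
    ZLattice.covolume_eq_measure_fundamentalDomain Λ _ (ZLattice.isAddFundamentalDomain b _),
    ZLattice.covolume_eq_measure_fundamentalDomain Λ _ (ZLattice.isAddFundamentalDomain b μ), hmap,
    measureReal_ennreal_smul_apply, ENNReal.toReal_ofReal (abs_nonneg _)]

section

variable {ι : Type*} (τ : ι → ℝ)

/-- The diagonal map `D_τ = diag(e^{τ i})`, as a linear homeomorphism so that lattices can be pulled
back along it. -/
noncomputable def scaling : (ι → ℝ) ≃L[ℝ] (ι → ℝ) :=
  ContinuousLinearEquiv.piCongrRight fun i =>
    ContinuousLinearEquiv.smulLeft (Units.mk0 (Real.exp (τ i)) (Real.exp_ne_zero _))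

lemma scaling_apply (x : ι → ℝ) (i : ι) : scaling τ x i = Real.exp (τ i) * x i := rfl

variable [Fintype ι]

lemma scaling_eq_mulVec [DecidableEq ι] (x : ι → ℝ) :
    scaling τ x = (Matrix.diagonal fun i => Real.exp (τ i)).mulVec x := by
  ext i
  rw [scaling_apply, Matrix.mulVec_diagonal]

lemma det_scaling :
    LinearMap.det (scaling τ : (ι → ℝ) →ₗ[ℝ] ι → ℝ) = Real.exp (∑ i, τ i) := by
  classical
  have hdiag : (scaling τ : (ι → ℝ) →ₗ[ℝ] ι → ℝ) =
      Matrix.toLin' (Matrix.diagonal fun i => Real.exp (τ i)) :=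
    LinearMap.ext fun x => scaling_eq_mulVec τ x
  rw [hdiag, LinearMap.det_toLin', Matrix.det_diagonal, Real.exp_sum]

lemma scaling_neg_dotProduct_scaling (x y : ι → ℝ) : scaling (-τ) x ⬝ᵥ scaling τ y = x ⬝ᵥ y :=
  Finset.sum_congr rfl fun i _ => by
    rw [scaling_apply, scaling_apply, Pi.neg_apply, mul_mul_mul_comm, ← Real.exp_add,
      neg_add_cancel, Real.exp_zero, one_mul]

/-- The lattice `D_τ⁻¹ Λ`, with respect to which the unit ball has the successive minima that the
box `D_τ B` has with respect to `Λ`. -/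
noncomputable abbrev rescale (Λ : Submodule ℤ (ι → ℝ)) : Submodule ℤ (ι → ℝ) :=
  ZLattice.comap ℝ Λ (scaling τ).toLinearMap

lemma mem_rescale {Λ : Submodule ℤ (ι → ℝ)} {x : ι → ℝ} : x ∈ rescale τ Λ ↔ scaling τ x ∈ Λ :=
  Iff.rfl

lemma log_covolume_rescale (Λ : Submodule ℤ (ι → ℝ)) [DiscreteTopology Λ] [IsZLattice ℝ Λ] :
    Real.log (ZLattice.covolume (rescale τ Λ)) =
      Real.log (ZLattice.covolume Λ) - ∑ i, τ i := by
  rw [covolume_comap_continuousLinearEquiv, det_scaling, Real.log_mul (by positivity)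
    (ZLattice.covolume_ne_zero Λ _), Real.log_abs, Real.log_inv, Real.log_exp]
  ring

end

variable {d : ℕ} (τ : Fin d → ℝ) (Λ : Submodule ℤ (Fin d → ℝ))

lemma dualLattice_rescale : dualLattice (rescale τ Λ) = rescale (-τ) (dualLattice Λ) := by
  ext y
  rw [mem_rescale, mem_dualLattice, mem_dualLattice]
  refine Iff.symm ((scaling τ).surjective.forall.trans (forall₂_congr fun x _ => ?_))
  rw [scaling_neg_dotProduct_scaling]

lemma smul_box {r : ℝ} (hr : 0 < r) : r • box τ = scaling τ '' closedBall 0 r := by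
  have hbox : box τ = scaling τ '' closedBall 0 1 := by simp only [box, scaling_eq_mulVec]
  rw [hbox, ← image_smul_set, smul_unitClosedBall, Real.norm_of_nonneg hr.le]

lemma successiveMinimum_box (k : ℕ) :
    successiveMinimum (box τ) Λ k = latticeMinimum (rescale τ Λ) k := by
  rw [successiveMinimum, latticeMinimum]
  congr 1
  ext r
  refine and_congr_right fun hr => ?_
  rw [(scaling τ).surjective.comp_left.exists]
  refine exists_congr fun v => and_congr
    ((scaling τ).toLinearEquiv.toLinearMap.linearIndependent_iff (scaling τ).ker) ?_
  rw [smul_box τ hr]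
  simp only [Function.comp_apply, (scaling τ).injective.mem_set_image, mem_closedBall_zero_iff,
    mem_rescale]

lemma L_eq_log_latticeMinimum (k : ℕ) : L k τ Λ = Real.log (latticeMinimum (rescale τ Λ) k) := by
  rw [L, successiveMinimum_box]

end Rescaling

section RealSequences

variable {a b : ℕ → ℝ} {n k : ℕ}

lemma sum_range_div_le_sum_range_succ_div (hk : 0 < k) (ha : ∀ i < k, a i ≤ a k) :
    (∑ i ∈ Finset.range k, a i) / k ≤ (∑ i ∈ Finset.range (k + 1), a i) / (k + 1) := by
  have hle : ∑ i ∈ Finset.range k, a i ≤ k * a k := by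
    simpa using Finset.sum_le_card_nsmul (Finset.range k) a (a k) fun i hi =>
      ha i (Finset.mem_range.1 hi)
  rw [Finset.sum_range_succ, div_le_div_iff₀ (by positivity) (by positivity)]
  linarith

lemma sum_range_succ_sub_div_le_sum_range_sub_div {h : ℝ} (hk : k + 1 < n)
    (ha : ∀ i ∈ Finset.Ico k n, a k ≤ a i) (hh : ∑ i ∈ Finset.range n, a i ≤ h) :
    (∑ i ∈ Finset.range (k + 1), a i - h) / (n - (k + 1)) ≤
      (∑ i ∈ Finset.range k, a i - h) / (n - k) := by
  have hkn : (k : ℝ) + 1 < n := by exact_mod_cast hk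
  have hle : (n - k) * a k ≤ ∑ i ∈ Finset.Ico k n, a i := by
    simpa [Nat.cast_sub (show k ≤ n by omega)] using Finset.card_nsmul_le_sum _ a (a k) ha
  rw [← Finset.sum_range_add_sum_Ico a (show k ≤ n by omega)] at hh
  rw [Finset.sum_range_succ, div_le_div_iff₀ (by linarith) (by linarith)]
  linarith

lemma abs_sum_range_sub_sum_range_sub_le {c h : ℝ} (hc : 0 ≤ c)
    (hab : ∀ i < n, -c ≤ a i + b (n - 1 - i)) (ha : ∑ i ∈ Finset.range n, a i ≤ h)
    (hb : ∑ i ∈ Finset.range n, b i ≤ -h) (hk : k ≤ n) :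
    |∑ i ∈ Finset.range k, a i - ∑ i ∈ Finset.range (n - k), b i - h| ≤ n * c := by
  have hlow {s : Finset ℕ} (hs : s ⊆ Finset.range n) :
      -(n * c) ≤ ∑ i ∈ s, a i + ∑ i ∈ s, b (n - 1 - i) := by
    have hcard : (s.card : ℝ) ≤ n := by simpa using Finset.card_le_card hs
    have := Finset.card_nsmul_le_sum s _ (-c) fun i hi => hab i (Finset.mem_range.1 (hs hi))
    rw [nsmul_eq_mul, Finset.sum_add_distrib] at this
    linarith [mul_le_mul_of_nonneg_right hcard hc]
  have hreflect : ∑ i ∈ Finset.range (n - k), b i = ∑ i ∈ Finset.Ico k n, b (n - 1 - i) := by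
    rw [← Finset.sum_range_reflect, Finset.sum_Ico_eq_sum_range]
    exact Finset.sum_congr rfl fun i _ => by congr 1; omega
  rw [← Finset.sum_range_add_sum_Ico _ hk] at ha
  rw [← Finset.sum_range_reflect, ← Finset.sum_range_add_sum_Ico _ hk, ← hreflect] at hb
  have hlow_range := hlow (Finset.range_subset_range.2 hk)
  have hlow_Ico := hlow (s := Finset.Ico k n) fun i hi =>
    Finset.mem_range.2 (Finset.mem_Ico.1 hi).2
  rw [← hreflect] at hlow_Ico
  exact abs_le.2 ⟨by linarith, by linarith⟩

end RealSequences

section LogarithmicMinima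

variable {d : ℕ} (τ : Fin d → ℝ) (Λ : Submodule ℤ (Fin d → ℝ))

lemma S_eq_sum_range (k : ℕ) : S k τ Λ = ∑ i ∈ Finset.range k, L (i + 1) τ Λ := by
  rw [S, Finset.range_eq_Ico, Finset.sum_Ico_add' (fun j => L j τ Λ) 0 k 1]
  rfl

variable [DiscreteTopology Λ] [IsZLattice ℝ Λ]

lemma L_le_L {j k : ℕ} (hj : j ≠ 0) (hjk : j ≤ k) (hk : k ≤ d) : L j τ Λ ≤ L k τ Λ := by
  rw [← Module.finrank_fin_fun (n := d) ℝ] at hk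
  rw [L_eq_log_latticeMinimum, L_eq_log_latticeMinimum]
  exact Real.log_le_log (latticeMinimum_pos _ hj (hjk.trans hk))
    (latticeMinimum_le_latticeMinimum _ hjk hk)

lemma sum_L_le : ∑ i ∈ Finset.range d, L (i + 1) τ Λ ≤
    Real.log (ZLattice.covolume Λ) - ∑ i, τ i := by
  simpa only [L_eq_log_latticeMinimum, log_covolume_rescale, Fintype.card_fin] using
    sum_log_latticeMinimum_le_log_covolume (rescale τ Λ)

lemma sum_L_neg_dualLattice_le : ∑ i ∈ Finset.range d, L (i + 1) (-τ) (dualLattice Λ) ≤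
    -(Real.log (ZLattice.covolume Λ) - ∑ i, τ i) := by
  have hlog := congrArg Real.log (covolume_mul_covolume_dualLattice Λ)
  rw [Real.log_mul (ZLattice.covolume_ne_zero _ _) (ZLattice.covolume_ne_zero _ _),
    Real.log_one] at hlog
  refine (sum_L_le (-τ) (dualLattice Λ)).trans_eq ?_
  simp only [Pi.neg_apply, Finset.sum_neg_distrib]
  linarith

lemma neg_log_le_L_add_L_neg_dualLattice {i : ℕ} (hi : i < d) :
    -Real.log d ≤ L (i + 1) τ Λ + L (d - 1 - i + 1) (-τ) (dualLattice Λ) := by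
  have hfin : finrank ℝ (Fin d → ℝ) = d := Module.finrank_fin_fun ℝ
  have hd : (d : ℝ) ≠ 0 := by exact_mod_cast (by omega : d ≠ 0)
  have hpos := latticeMinimum_pos (rescale τ Λ) i.succ_ne_zero (by omega)
  have hpos' := latticeMinimum_pos (dualLattice (rescale τ Λ)) (d - 1 - i).succ_ne_zero (by omega)
  have hle : 1 ≤ d * (latticeMinimum (rescale τ Λ) (i + 1) *
      latticeMinimum (dualLattice (rescale τ Λ)) (d - 1 - i + 1)) :=
    one_le_mul_latticeMinimum dotProductBilin_nondegenerate
      (fun x y => by simpa using abs_dotProduct_le x y) (le_refl (dualLattice _))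
      (by omega) (by omega) (by omega)
  have hlog := Real.log_nonneg hle
  rw [Real.log_mul hd (mul_pos hpos hpos').ne', Real.log_mul hpos.ne' hpos'.ne'] at hlog
  rw [L_eq_log_latticeMinimum, L_eq_log_latticeMinimum, ← dualLattice_rescale]
  linarith

end LogarithmicMinima

end MultParamGeom

open MultParamGeom in
theorem theoremt_general (d : ℕ) :
    (∃ C : ℝ, ∀ (Λ : Submodule ℤ (Fin d → ℝ)) [DiscreteTopology Λ] [IsZLattice ℝ Λ]
      (τ : Fin d → ℝ) (k : ℕ), k ≤ d →
        |S k τ Λ - S (d - k) (-τ) (dualLattice Λ) -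
          (Real.log (ZLattice.covolume Λ) - ∑ i, τ i)| ≤ C) ∧
    ∀ (Λ : Submodule ℤ (Fin d → ℝ)) [DiscreteTopology Λ] [IsZLattice ℝ Λ] (τ : Fin d → ℝ),
      (∀ k : ℕ, 1 ≤ k → k + 1 ≤ d → S k τ Λ / k ≤ S (k + 1) τ Λ / (k + 1)) ∧
      ∀ k : ℕ, k + 1 < d →
        (S (k + 1) τ Λ - (Real.log (ZLattice.covolume Λ) - ∑ i, τ i)) / (d - (k + 1)) ≤
          (S k τ Λ - (Real.log (ZLattice.covolume Λ) - ∑ i, τ i)) / (d - k) := by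
  simp only [S_eq_sum_range]
  refine ⟨⟨d * Real.log d, fun Λ _ _ τ k hk => ?_⟩, fun Λ _ _ τ => ⟨fun k hk hkd => ?_,
    fun k hkd => ?_⟩⟩
  · exact abs_sum_range_sub_sum_range_sub_le (Real.log_natCast_nonneg d)
      (fun i hi => neg_log_le_L_add_L_neg_dualLattice τ Λ hi)
      (sum_L_le τ Λ) (sum_L_neg_dualLattice_le τ Λ) hk
  · exact sum_range_div_le_sum_range_succ_div hk fun i hi =>
      L_le_L τ Λ i.succ_ne_zero (by omega) hkd
  · exact sum_range_succ_sub_div_le_sum_range_sub_div hkd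
      (fun i hi => by
        rw [Finset.mem_Ico] at hi
        exact L_le_L τ Λ k.succ_ne_zero (by omega) (by omega))
      (sum_L_le τ Λ)

theorem theoremt (d : ℕ) :
    -- (i), with a constant that depends on the dimension only
    (∃ C : ℝ, ∀ (Λ : Submodule ℤ (Fin d → ℝ)) [DiscreteTopology Λ] [IsZLattice ℝ Λ],
      ZLattice.covolume Λ = 1 → ∀ τ : Fin d → ℝ, ∑ i, τ i = 0 →
        ∀ k : ℕ, 1 ≤ k → k < d →
          |MultParamGeom.S k τ Λ -
            MultParamGeom.S (d - k) (-τ) (MultParamGeom.dualLattice Λ)| ≤ C) ∧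
    (∀ (Λ : Submodule ℤ (Fin d → ℝ)) [DiscreteTopology Λ] [IsZLattice ℝ Λ],
      ZLattice.covolume Λ = 1 → ∀ τ : Fin d → ℝ, ∑ i, τ i = 0 →
        -- (ii)
        (∀ k : ℕ, 1 ≤ k → k + 1 < d →
          MultParamGeom.S k τ Λ / (k : ℝ) ≤ MultParamGeom.S (k + 1) τ Λ / ((k : ℝ) + 1)) ∧
        -- (iii)
        (∀ k : ℕ, 1 ≤ k → k + 1 < d →
          MultParamGeom.S k τ Λ / ((d : ℝ) - (k : ℝ)) ≥
            MultParamGeom.S (k + 1) τ Λ / ((d : ℝ) - ((k : ℝ) + 1)))) := by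
  obtain ⟨⟨C, hduality⟩, hmonotone⟩ := theoremt_general d
  refine ⟨⟨C, fun Λ _ _ hΛ τ hτ k _ hk => ?_⟩, fun Λ _ _ hΛ τ hτ =>
    ⟨fun k hk hkd => (hmonotone Λ τ).1 k hk hkd.le, fun k _ hkd => ?_⟩⟩
  · simpa [hΛ, hτ] using hduality Λ τ k hk.le
  · simpa [hΛ, hτ] using (hmonotone Λ τ).2 k hkd
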